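/- Let $\xi=(\xi_t)_{t\ge 0}$ be a (possibly killed) subordinator: a $[0,\infty]$-valued process which almost surely has nondecreasing right-continuous paths with $\xi_0=0$, and such that for all $s,t\ge 0$, conditionally on $\{\xi_s<\infty\}$, the increment $\xi_{s+t}-\xi_s$ is independent of $(\xi_r)_{r\le s}$ and distributed as $\xi_t$. With the convention $e^{-\infty}=0$ (and $e^{-q\cdot\infty}=0$ also for $q=0$), let $\phi(q)=-\log\mathbb E[e^{-q\xi_1}]$ be its Laplace exponent and $\Phi(q)=\int_0^q\phi(s)\,\mathrm ds$ for $q\ge 0$, and let $$\rho(t)=\inf\Big\{r\ge 0:\int_0^r\xi_u\,\mathrm du\ge t\Big\},\qquad t\ge 0,\quad \inf\emptyset=\infty,\quad \xi_\infty:=\sup_{s\ge 0}\xi_s .$$ Then for every $q>0$ there exists $a(q)\in(0,\infty)$ such that for all $t\ge 0$ $$\mathbb E\big[e^{-q\xi_{\rho(t)}}\big]\le a(q)\,\big(1+t^{1/8}\big)\,e^{-2\sqrt{\Phi(q)\,t}} .$$ -/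

import Mathlib

open MeasureTheory
open scoped NNReal ENNReal

/-- `ξ` is a (possibly killed) subordinator under `P`: a `[0, ∞]`-valued process which almost surely
starts at `0` and has nondecreasing right-continuous paths, and such that, for all times `s` and `t`,
on the event `{ξ s < ∞}` that the process is still alive at time `s`, the increment
`ξ (s + t) - ξ s` is independent of `σ(ξ r, r ≤ s)` and has the same law as `ξ t`.
The value `∞` is the cemetery state; it is absorbing because paths are nondecreasing. -/
structure IsSubordinator {Ω : Type*} [MeasurableSpace Ω] (ξ : ℝ≥0 → Ω → ℝ≥0∞) (P : Measure Ω) :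
    Prop where
  measurable : ∀ t, Measurable (ξ t)
  zero : ∀ᵐ ω ∂P, ξ 0 ω = 0
  mono : ∀ᵐ ω ∂P, Monotone fun t => ξ t ω
  rightCont : ∀ᵐ ω ∂P, ∀ t, ContinuousWithinAt (fun s => ξ s ω) (Set.Ici t) t
  increments : ∀ (s t : ℝ≥0) (A : Set Ω) (B : Set ℝ≥0∞),
    MeasurableSet[⨆ r : Set.Iic s, MeasurableSpace.comap (ξ r) inferInstance] A →
    MeasurableSet B →
      P (A ∩ {ω | ξ s ω < ∞} ∩ {ω | ξ (s + t) ω - ξ s ω ∈ B}) =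
        P (A ∩ {ω | ξ s ω < ∞}) * P {ω | ξ t ω ∈ B}

namespace IsSubordinator

/-- `e^{-q x}` for `x ∈ [0, ∞]`, with the convention `e^{-q ∞} = 0` (also for `q = 0`). -/
noncomputable def expNeg (q : ℝ) (x : ℝ≥0∞) : ℝ :=
  if x = ∞ then 0 else Real.exp (-(q * x.toReal))

/-- The Laplace exponent `φ(q) = -log E[e^{-q ξ_1}]`. -/
noncomputable def phi {Ω : Type*} [MeasurableSpace Ω] (ξ : ℝ≥0 → Ω → ℝ≥0∞) (P : Measure Ω)
    (q : ℝ) : ℝ :=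
  -Real.log (∫ ω, expNeg q (ξ 1 ω) ∂P)

/-- `Φ(q) = ∫_0^q φ(s) ds`. -/
noncomputable def Phi {Ω : Type*} [MeasurableSpace Ω] (ξ : ℝ≥0 → Ω → ℝ≥0∞) (P : Measure Ω)
    (q : ℝ) : ℝ :=
  ∫ s in (0 : ℝ)..q, phi ξ P s

/-- The time change `ρ(t) = inf {r ≥ 0 : ∫_0^r ξ_u du ≥ t} ∈ [0, ∞]`, with `inf ∅ = ∞`. -/
noncomputable def rho {Ω : Type*} (ξ : ℝ≥0 → Ω → ℝ≥0∞) (t : ℝ≥0) (ω : Ω) : ℝ≥0∞ :=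
  sInf ((fun r : ℝ≥0 => (r : ℝ≥0∞)) ''
    {r : ℝ≥0 | (t : ℝ≥0∞) ≤ ∫⁻ u in Set.Ioc (0 : ℝ) r, ξ u.toNNReal ω})

/-- The time-changed process `ξ_{ρ(t)}`, where `ξ_∞ = sup_s ξ_s`. The value at infinity is only
used when the whole path vanishes: otherwise `∫_0^r ξ_u du → ∞` and `ρ(t) < ∞`. -/
noncomputable def timeChanged {Ω : Type*} (ξ : ℝ≥0 → Ω → ℝ≥0∞) (t : ℝ≥0) (ω : Ω) : ℝ≥0∞ :=
  if rho ξ t ω = ∞ then ⨆ s : ℝ≥0, ξ s ω else ξ (rho ξ t ω).toNNReal ω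

end IsSubordinator

namespace IsSubordinator

/-! ### The exponential functional -/

/-! Write `A` for the integral of `ξ`. For each slope `c > 0`, `exp (c A_r - c r ξ_r + ∫_0^r φ (c s)
ds)` is a martingale, because `r ξ_r - A_r = ∫_0^r s dξ_s`. Stopping at `s = ρ(t)`, where `A = t`,
and setting `x = ξ_s` gives `E exp (c t - c s x + Φ (c s) / c) ≤ 1`. By convexity, `Φ (c s) ≥ Φ q +
φ q (c s - q)`. With `c = q / r` the exponent is therefore at least `-q x + (c t + Φ q / c) + (φ q -
c x) (s - r)`.

The last product is harmless once `r` is close to `s` or `q x / φ q`, or lies between them, but this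
`r` is random. Letting `r` run over the squares `(i + 1) ^ 2` always leaves one value for which the
product is at least `-9 φ q` (`exists_sq_sub_mul_sub_le`). Hence `e^{-q x}` is bounded by a weighted
sum of the stopped martingales (`expNeg_le_tsum`), and its expectation by the sum of the weights.
Since `c t + Φ q / c` exceeds its minimum `2 √(Φ q t)` by at least a quadratic in `i` (`saddle_le`),
that sum is Gaussian and uniformly bounded. The factor `1 + t^{1/8}` is thus not needed.

The argument is carried out on grids of mesh `1 / (n + 1)`, where the martingale is a finite
product; `tendsto_crossing` and Fatou's lemma remove the grid. -/

theorem expNeg_top (q : ℝ) : expNeg q ∞ = 0 := by simp [expNeg]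

theorem expNeg_of_ne_top (q : ℝ) {x : ℝ≥0∞} (hx : x ≠ ∞) :
    expNeg q x = Real.exp (-(q * x.toReal)) := by simp [expNeg, hx]

theorem expNeg_nonneg (q : ℝ) (x : ℝ≥0∞) : 0 ≤ expNeg q x := by
  unfold expNeg; split_ifs <;> positivity

theorem expNeg_le_one {q : ℝ} (hq : 0 ≤ q) (x : ℝ≥0∞) : expNeg q x ≤ 1 := by
  unfold expNeg
  split_ifs
  · exact zero_le_one
  · exact Real.exp_le_one_iff.2 (neg_nonpos.2 (by positivity))

theorem expNeg_anti_left {p q : ℝ} (hpq : p ≤ q) (x : ℝ≥0∞) : expNeg q x ≤ expNeg p x := by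
  unfold expNeg
  split_ifs
  · exact le_rfl
  · gcongr

theorem expNeg_add (q : ℝ) (x y : ℝ≥0∞) : expNeg q (x + y) = expNeg q x * expNeg q y := by
  rcases eq_or_ne x ∞ with rfl | hx
  · simp [expNeg_top]
  rcases eq_or_ne y ∞ with rfl | hy
  · simp [expNeg_top]
  rw [expNeg_of_ne_top q hx, expNeg_of_ne_top q hy,
    expNeg_of_ne_top q (ENNReal.add_ne_top.2 ⟨hx, hy⟩), ENNReal.toReal_add hx hy, ← Real.exp_add]
  ring_nf

theorem measurable_expNeg (q : ℝ) : Measurable (expNeg q) :=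
  Measurable.ite (measurableSet_singleton ∞) measurable_const
    (Real.measurable_exp.comp (ENNReal.measurable_toReal.const_mul q).neg)

theorem continuousAt_expNeg (q : ℝ) {x : ℝ≥0∞} (hx : x ≠ ∞) : ContinuousAt (expNeg q) x := by
  have h : ContinuousAt (fun y : ℝ≥0∞ => Real.exp (-(q * y.toReal))) x :=
    Real.continuous_exp.continuousAt.comp
      ((continuousAt_const.mul (ENNReal.continuousAt_toReal hx)).neg)
  refine h.congr ?_
  filter_upwards [isOpen_ne.mem_nhds hx] with y hy
  exact (expNeg_of_ne_top q hy).symm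

variable {Ω : Type*} {ξ : ℝ≥0 → Ω → ℝ≥0∞}

/-! ### Independence of increments -/

/-- The natural filtration of `ξ`. -/
abbrev past (ξ : ℝ≥0 → Ω → ℝ≥0∞) (s : ℝ≥0) : MeasurableSpace Ω :=
  ⨆ r : Set.Iic s, MeasurableSpace.comap (ξ r) inferInstance

theorem measurable_past {r s : ℝ≥0} (hrs : r ≤ s) : Measurable[past ξ s] (ξ r) :=
  (comap_measurable (ξ r)).mono
    (le_iSup (fun r : Set.Iic s => MeasurableSpace.comap (ξ r) inferInstance) ⟨r, hrs⟩) le_rfl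

variable [MeasurableSpace Ω] {P : Measure Ω}

theorem past_le (h : ∀ t, Measurable (ξ t)) (s : ℝ≥0) :
    past ξ s ≤ (inferInstance : MeasurableSpace Ω) :=
  iSup_le fun r => (h r).comap_le

/-- Passes from events to functions: the defining identity says that two measures agree on the past,
and then that the increment has law proportional to that of `ξ t` under density `f`. Vanishing of
`f` after killing makes the restriction to the alive event invisible. -/
theorem lintegral_mul_increment [IsProbabilityMeasure P] (hξ : IsSubordinator ξ P) (s t : ℝ≥0)
    {f : Ω → ℝ≥0∞} (hf : Measurable[past ξ s] f) (hf0 : ∀ᵐ ω ∂P, ξ s ω = ∞ → f ω = 0)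
    {g : ℝ≥0∞ → ℝ≥0∞} (hg : Measurable g) :
    ∫⁻ ω, f ω * g (ξ (s + t) ω - ξ s ω) ∂P = (∫⁻ ω, f ω ∂P) * ∫⁻ ω, g (ξ t ω) ∂P := by
  have hle := past_le hξ.measurable s
  have hf' : Measurable f := hf.mono hle le_rfl
  set L : Set Ω := {ω | ξ s ω < ∞} with hL
  have hLm : MeasurableSet L := measurableSet_lt (hξ.measurable s) measurable_const
  set D : Ω → ℝ≥0∞ := fun ω => ξ (s + t) ω - ξ s ω with hD
  have hDm : Measurable D := (hξ.measurable _).sub (hξ.measurable _)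
  have key : ∀ B : Set ℝ≥0∞, MeasurableSet B →
      ∫⁻ ω in L ∩ D ⁻¹' B, f ω ∂P = (∫⁻ ω in L, f ω ∂P) * P (ξ t ⁻¹' B) := by
    intro B hB
    have h1 : (P.restrict (L ∩ D ⁻¹' B)).trim hle = P (ξ t ⁻¹' B) • (P.restrict L).trim hle := by
      refine @Measure.ext _ (past ξ s) _ _ fun A hA => ?_
      rw [trim_measurableSet_eq hle hA, Measure.smul_apply, trim_measurableSet_eq hle hA,
        Measure.restrict_apply (hle _ hA), Measure.restrict_apply (hle _ hA), smul_eq_mul, mul_comm]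
      have := hξ.increments s t A B hA hB
      rw [← Set.inter_assoc]
      exact this
    rw [← lintegral_trim hle hf, h1, lintegral_smul_measure, lintegral_trim hle hf, smul_eq_mul,
      mul_comm]
  have h2 : ((P.restrict L).withDensity f).map D = (∫⁻ ω in L, f ω ∂P) • P.map (ξ t) := by
    refine Measure.ext fun B hB => ?_
    rw [Measure.map_apply hDm hB, withDensity_apply _ (hDm hB), Measure.restrict_restrict (hDm hB),
      Set.inter_comm, key B hB, Measure.smul_apply, Measure.map_apply (hξ.measurable t) hB,
      smul_eq_mul]
  have hsupp : ∀ F : Ω → ℝ≥0∞, (∀ᵐ ω ∂P, ξ s ω = ∞ → F ω = 0) →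
      ∫⁻ ω in L, F ω ∂P = ∫⁻ ω, F ω ∂P := by
    intro F hF
    rw [← lintegral_indicator hLm]
    refine lintegral_congr_ae ?_
    filter_upwards [hF] with ω hω
    by_cases h : ω ∈ L
    · simp [h]
    · rw [Set.indicator_of_notMem h, hω (by simpa [hL] using h)]
  calc ∫⁻ ω, f ω * g (D ω) ∂P = ∫⁻ ω in L, f ω * g (D ω) ∂P := by
        refine (hsupp _ ?_).symm
        filter_upwards [hf0] with ω hω h
        rw [hω h, zero_mul]
    _ = ∫⁻ ω, g (D ω) ∂((P.restrict L).withDensity f) :=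
        (lintegral_withDensity_eq_lintegral_mul _ hf' (hg.comp hDm)).symm
    _ = ∫⁻ x, g x ∂(((P.restrict L).withDensity f).map D) := (lintegral_map hg hDm).symm
    _ = (∫⁻ ω in L, f ω ∂P) * ∫⁻ ω, g (ξ t ω) ∂P := by
        rw [h2, lintegral_smul_measure, lintegral_map hg (hξ.measurable t), smul_eq_mul]
    _ = _ := by rw [hsupp f hf0]

/-! ### The Laplace transform -/

theorem integrable_expNeg [IsProbabilityMeasure P] {q : ℝ} (hq : 0 ≤ q) {X : Ω → ℝ≥0∞}
    (hX : AEMeasurable X P) : Integrable (fun ω => expNeg q (X ω)) P := by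
  refine Integrable.of_bound ((measurable_expNeg q).comp_aemeasurable hX).aestronglyMeasurable 1
    (Filter.Eventually.of_forall fun ω => ?_)
  rw [Real.norm_of_nonneg (expNeg_nonneg _ _)]
  exact expNeg_le_one hq _

/-- The Laplace transform of `ξ t`, as a lower integral. -/
noncomputable def laplace (ξ : ℝ≥0 → Ω → ℝ≥0∞) (P : Measure Ω) (q : ℝ) (t : ℝ≥0) : ℝ≥0∞ :=
  ∫⁻ ω, ENNReal.ofReal (expNeg q (ξ t ω)) ∂P

theorem laplace_eq [IsProbabilityMeasure P] (hξ : IsSubordinator ξ P) {q : ℝ} (hq : 0 ≤ q)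
    (t : ℝ≥0) : laplace ξ P q t = ENNReal.ofReal (∫ ω, expNeg q (ξ t ω) ∂P) :=
  (ofReal_integral_eq_lintegral_ofReal (integrable_expNeg hq (hξ.measurable t).aemeasurable)
    (Filter.Eventually.of_forall fun _ => expNeg_nonneg _ _)).symm

theorem laplace_add [IsProbabilityMeasure P] (hξ : IsSubordinator ξ P) (q : ℝ) (s t : ℝ≥0) :
    laplace ξ P q (s + t) = laplace ξ P q s * laplace ξ P q t := by
  have hm : Measurable fun x => ENNReal.ofReal (expNeg q x) := (measurable_expNeg q).ennreal_ofReal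
  rw [laplace, laplace, laplace, ← hξ.lintegral_mul_increment s t
    (f := fun ω => ENNReal.ofReal (expNeg q (ξ s ω))) (hm.comp (measurable_past le_rfl))
    (Filter.Eventually.of_forall fun ω h => by simp [h, expNeg_top]) hm]
  refine lintegral_congr_ae ?_
  filter_upwards [hξ.mono] with ω hω
  rw [← ENNReal.ofReal_mul (expNeg_nonneg _ _), ← expNeg_add,
    add_tsub_cancel_of_le (hω le_self_add)]

theorem laplace_zero [IsProbabilityMeasure P] (hξ : IsSubordinator ξ P) (q : ℝ) :
    laplace ξ P q 0 = 1 := by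
  have : ∀ᵐ ω ∂P, ENNReal.ofReal (expNeg q (ξ 0 ω)) = 1 := by
    filter_upwards [hξ.zero] with ω hω
    simp [hω, expNeg]
  rw [laplace, lintegral_congr_ae this, lintegral_one, measure_univ]

theorem laplace_nat_mul [IsProbabilityMeasure P] (hξ : IsSubordinator ξ P) (q : ℝ) (t : ℝ≥0)
    (n : ℕ) : laplace ξ P q (n * t) = laplace ξ P q t ^ n := by
  induction n with
  | zero => simp [laplace_zero hξ]
  | succ n ih => rw [Nat.cast_succ, add_one_mul, laplace_add hξ, ih, pow_succ]

theorem tendsto_laplace [IsProbabilityMeasure P] (hξ : IsSubordinator ξ P) {q : ℝ} (hq : 0 ≤ q)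
    {u : ℕ → ℝ≥0} (hu : Filter.Tendsto u Filter.atTop (nhds 0)) :
    Filter.Tendsto (fun n => laplace ξ P q (u n)) Filter.atTop (nhds 1) := by
  rw [← laplace_zero hξ q]
  refine tendsto_lintegral_of_dominated_convergence (fun _ => 1)
    (fun n => ((measurable_expNeg q).comp (hξ.measurable _)).ennreal_ofReal)
    (fun n => Filter.Eventually.of_forall fun ω => ?_) (by simp) ?_
  · exact ENNReal.ofReal_le_one.2 (expNeg_le_one hq _)
  · filter_upwards [hξ.zero, hξ.rightCont] with ω h0 hc
    have h1 : Filter.Tendsto (fun n => ξ (u n) ω) Filter.atTop (nhds (ξ 0 ω)) := by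
      refine (hc 0).tendsto.comp (tendsto_nhdsWithin_iff.2 ⟨hu, ?_⟩)
      exact Filter.Eventually.of_forall fun n => Set.mem_Ici.2 zero_le
    have h2 : ContinuousAt (expNeg q) (ξ 0 ω) := continuousAt_expNeg q (by simp [h0])
    exact (ENNReal.continuous_ofReal.tendsto _).comp (h2.tendsto.comp h1)

/-- The mesh `1 / (n + 1)`. -/
noncomputable def mesh (n : ℕ) : ℝ≥0 := ((n : ℝ≥0) + 1)⁻¹

theorem mesh_pos (n : ℕ) : 0 < mesh n := by unfold mesh; positivity

theorem mesh_le_one (n : ℕ) : mesh n ≤ 1 := inv_le_one_of_one_le₀ (by simp)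

theorem tendsto_mesh : Filter.Tendsto mesh Filter.atTop (nhds 0) := by
  refine NNReal.tendsto_coe.1 ((tendsto_one_div_add_atTop_nhds_zero_nat (𝕜 := ℝ)).congr fun n => ?_)
  simp [mesh]

theorem laplace_mesh_pow [IsProbabilityMeasure P] (hξ : IsSubordinator ξ P) (q : ℝ) (n : ℕ) :
    laplace ξ P q (mesh n) ^ (n + 1) = laplace ξ P q 1 := by
  rw [← laplace_nat_mul hξ]
  congr 1
  rw [mesh, Nat.cast_succ, mul_inv_cancel₀ (by positivity)]

/-- By right continuity at `0` the transform is positive at some small mesh, and its value at time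
`1` is a power of that. This rules out the default value of `Real.log` at `0` in `phi`. -/
theorem laplace_one_pos [IsProbabilityMeasure P] (hξ : IsSubordinator ξ P) {q : ℝ} (hq : 0 ≤ q) :
    0 < laplace ξ P q 1 := by
  obtain ⟨n, hn⟩ := ((tendsto_laplace hξ hq tendsto_mesh).eventually
    (lt_mem_nhds (show (0 : ℝ≥0∞) < 1 by simp))).exists
  rw [← laplace_mesh_pow hξ q n]
  exact ENNReal.pow_pos hn _

theorem integral_expNeg_pos [IsProbabilityMeasure P] (hξ : IsSubordinator ξ P) {q : ℝ}
    (hq : 0 ≤ q) : 0 < ∫ ω, expNeg q (ξ 1 ω) ∂P := by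
  have := laplace_one_pos hξ hq
  rwa [laplace_eq hξ hq, ENNReal.ofReal_pos] at this

theorem laplace_one [IsProbabilityMeasure P] (hξ : IsSubordinator ξ P) {q : ℝ} (hq : 0 ≤ q) :
    laplace ξ P q 1 = ENNReal.ofReal (Real.exp (-phi ξ P q)) := by
  rw [laplace_eq hξ hq, phi, neg_neg, Real.exp_log (integral_expNeg_pos hξ hq)]

/-- Uniqueness of `(n + 1)`-th roots suffices, since only times `1 / (n + 1)` are ever used as
steps. -/
theorem laplace_mesh [IsProbabilityMeasure P] (hξ : IsSubordinator ξ P) {q : ℝ} (hq : 0 ≤ q)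
    (n : ℕ) : laplace ξ P q (mesh n) = ENNReal.ofReal (Real.exp (-(mesh n * phi ξ P q))) := by
  refine (ENNReal.pow_right_strictMono (Nat.succ_ne_zero n)).injective ?_
  change _ ^ (n + 1) = _ ^ (n + 1)
  rw [laplace_mesh_pow hξ, laplace_one hξ hq, ← ENNReal.ofReal_pow (Real.exp_nonneg _),
    ← Real.exp_nat_mul]
  congr 2
  have : ((n + 1 : ℕ) : ℝ) * mesh n = 1 := by
    rw [mesh]; push_cast; exact mul_inv_cancel₀ (by positivity)
  linear_combination (phi ξ P q) * this

theorem phi_nonneg [IsProbabilityMeasure P] (hξ : IsSubordinator ξ P) {q : ℝ} (hq : 0 ≤ q) :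
    0 ≤ phi ξ P q := by
  rw [phi, neg_nonneg]
  refine Real.log_nonpos (integral_nonneg fun _ => expNeg_nonneg _ _) ?_
  calc ∫ ω, expNeg q (ξ 1 ω) ∂P ≤ ∫ _, (1 : ℝ) ∂P :=
        integral_mono (integrable_expNeg hq (hξ.measurable 1).aemeasurable) (integrable_const _)
          fun _ => expNeg_le_one hq _
    _ = 1 := by simp

theorem phi_monotoneOn [IsProbabilityMeasure P] (hξ : IsSubordinator ξ P) :
    MonotoneOn (phi ξ P) (Set.Ici 0) := by
  intro p hp q hq hpq
  rw [phi, phi, neg_le_neg_iff]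
  exact Real.log_le_log (integral_expNeg_pos hξ hq)
    (integral_mono (integrable_expNeg hq (hξ.measurable 1).aemeasurable)
      (integrable_expNeg hp (hξ.measurable 1).aemeasurable) fun _ => expNeg_anti_left hpq _)

/-- `Φ` is convex with derivative `φ`. -/
theorem phi_mul_sub_le [IsProbabilityMeasure P] (hξ : IsSubordinator ξ P) {x y : ℝ} (hx : 0 ≤ x)
    (hy : 0 ≤ y) : phi ξ P x * (y - x) ≤ Phi ξ P y - Phi ξ P x := by
  have hint : ∀ a b : ℝ, 0 ≤ a → 0 ≤ b → IntervalIntegrable (phi ξ P) volume a b := by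
    intro a b ha hb
    refine MonotoneOn.intervalIntegrable ((phi_monotoneOn hξ).mono fun z hz => ?_)
    exact (le_min ha hb).trans hz.1
  have hsub : Phi ξ P y - Phi ξ P x = ∫ s in x..y, phi ξ P s := by
    rw [Phi, Phi, intervalIntegral.integral_interval_sub_left (hint _ _ le_rfl hy)
      (hint _ _ le_rfl hx)]
  rw [hsub]
  rcases le_total x y with h | h
  · have := intervalIntegral.integral_mono_on h (intervalIntegrable_const (c := phi ξ P x))
      (hint x y hx hy) fun z hz => phi_monotoneOn hξ hx (hx.trans hz.1) hz.1
    simpa [mul_comm] using this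
  · have := intervalIntegral.integral_mono_on h (hint y x hy hx)
      (intervalIntegrable_const (c := phi ξ P x))
      fun z hz => phi_monotoneOn hξ (hy.trans hz.1) hx hz.2
    rw [intervalIntegral.integral_symm]
    simp only [intervalIntegral.integral_const, smul_eq_mul] at this
    linarith

end IsSubordinator

namespace IsSubordinator

/-! ### Riemann sums along a nondecreasing path -/

/-- The lower Riemann sum `δ ∑_{j < k} x (j δ)`. -/
noncomputable def lowerSum (x : ℝ≥0 → ℝ≥0∞) (δ : ℝ≥0) (k : ℕ) : ℝ≥0∞ :=
  ∑ j ∈ Finset.range k, δ * x (j * δ)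

theorem lowerSum_succ (x : ℝ≥0 → ℝ≥0∞) (δ : ℝ≥0) (k : ℕ) :
    lowerSum x δ (k + 1) = lowerSum x δ k + δ * x (k * δ) := Finset.sum_range_succ _ _

theorem lowerSum_mono (x : ℝ≥0 → ℝ≥0∞) (δ : ℝ≥0) : Monotone (lowerSum x δ) :=
  monotone_nat_of_le_succ fun k => by rw [lowerSum_succ]; exact le_self_add

/-- The integral of the path `x` over `(0, r]`. -/
noncomputable def pathIntegral (x : ℝ≥0 → ℝ≥0∞) (r : ℝ≥0) : ℝ≥0∞ :=
  ∫⁻ u in Set.Ioc (0 : ℝ) r, x u.toNNReal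

theorem pathIntegral_mono (x : ℝ≥0 → ℝ≥0∞) : Monotone (pathIntegral x) := fun _ _ h =>
  lintegral_mono_set (Set.Ioc_subset_Ioc_right (NNReal.coe_le_coe.2 h))

theorem pathIntegral_zero (x : ℝ≥0 → ℝ≥0∞) : pathIntegral x 0 = 0 := by simp [pathIntegral]

variable {x : ℝ≥0 → ℝ≥0∞}

theorem pathIntegral_add (a b : ℝ≥0) : pathIntegral x (a + b) =
    pathIntegral x a + ∫⁻ u in Set.Ioc (a : ℝ) (a + b : ℝ≥0), x u.toNNReal := by
  rw [pathIntegral, pathIntegral, ← lintegral_union measurableSet_Ioc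
    (Set.Ioc_disjoint_Ioc_of_le le_rfl),
    Set.Ioc_union_Ioc_eq_Ioc (NNReal.coe_nonneg a) (NNReal.coe_le_coe.2 le_self_add)]

theorem volume_Ioc_add (a b : ℝ≥0) : volume (Set.Ioc (a : ℝ) (a + b : ℝ≥0)) = b := by
  rw [Real.volume_Ioc]; simp

theorem pathIntegral_add_ge (hx : Monotone x) (a b : ℝ≥0) :
    pathIntegral x a + b * x a ≤ pathIntegral x (a + b) := by
  rw [pathIntegral_add]
  gcongr
  rw [mul_comm, ← volume_Ioc_add a b]
  refine setLIntegral_const _ _ |>.symm.le.trans (setLIntegral_mono' measurableSet_Ioc ?_)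
  intro u hu
  exact hx (NNReal.le_toNNReal_of_coe_le hu.1.le)

theorem pathIntegral_add_le (hx : Monotone x) (a b : ℝ≥0) :
    pathIntegral x (a + b) ≤ pathIntegral x a + b * x (a + b) := by
  rw [pathIntegral_add]
  gcongr
  rw [mul_comm, ← volume_Ioc_add a b]
  refine (setLIntegral_mono' measurableSet_Ioc ?_).trans (setLIntegral_const _ _).le
  intro u hu
  exact hx (Real.toNNReal_le_iff_le_coe.2 hu.2)

theorem lowerSum_le_pathIntegral (hx : Monotone x) (δ : ℝ≥0) (k : ℕ) :
    lowerSum x δ k ≤ pathIntegral x (k * δ) := by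
  induction k with
  | zero => simp [lowerSum]
  | succ k ih =>
    rw [lowerSum_succ, Nat.cast_succ, add_one_mul]
    exact (add_le_add_left ih _).trans (pathIntegral_add_ge hx _ _)

theorem pathIntegral_le_lowerSum_add (hx : Monotone x) (δ : ℝ≥0) (k : ℕ) :
    pathIntegral x (k * δ) ≤ lowerSum x δ k + δ * x (k * δ) := by
  induction k with
  | zero => simp [lowerSum, pathIntegral_zero]
  | succ k ih =>
    rw [Nat.cast_succ, add_one_mul]
    refine (pathIntegral_add_le hx _ _).trans ?_
    rw [lowerSum_succ]
    gcongr

theorem pathIntegral_le_mul (hx : Monotone x) (r : ℝ≥0) : pathIntegral x r ≤ r * x r := by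
  simpa [pathIntegral_zero] using pathIntegral_add_le hx 0 r

/-- For a path that does not vanish identically, the lower sums cross every level. -/
theorem exists_lowerSum_crossing (hx : Monotone x) {u : ℝ≥0} (hu : x u ≠ 0) {δ : ℝ≥0}
    (hδ : 0 < δ) {t : ℝ≥0} (ht : 0 < t) :
    ∃ k, lowerSum x δ k < t ∧ (t : ℝ≥0∞) ≤ lowerSum x δ (k + 1) := by
  have hex : ∃ N, (t : ℝ≥0∞) ≤ lowerSum x δ N := by
    obtain ⟨m, hm⟩ := exists_nat_ge (u / δ)
    have hum : u ≤ m * δ := (div_le_iff₀ hδ).1 hm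
    have hbound : ∀ l : ℕ, (l : ℝ≥0∞) * (δ * x (m * δ)) ≤ lowerSum x δ (m + l) := by
      intro l
      induction l with
      | zero => simp
      | succ l ih =>
        rw [← add_assoc, lowerSum_succ, Nat.cast_succ, add_one_mul]
        gcongr
        exact hx (by gcongr; simp)
    have hpos : (δ : ℝ≥0∞) * x (m * δ) ≠ 0 :=
      mul_ne_zero (by simpa using hδ.ne')
        ((pos_iff_ne_zero.2 hu).trans_le (hx hum)).ne'
    obtain ⟨l, hl⟩ := ENNReal.exists_nat_mul_gt hpos (ENNReal.coe_ne_top (r := t))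
    exact ⟨m + l, hl.le.trans (hbound l)⟩
  classical
  -- The empty sum is below `t > 0`, so the first index reaching `t` has a predecessor.
  have h0 : Nat.find hex ≠ 0 := by
    intro h
    have := Nat.find_spec hex
    rw [h] at this
    simp [lowerSum] at this
    exact ht.ne' this
  obtain ⟨k, hk⟩ := Nat.exists_eq_succ_of_ne_zero h0
  refine ⟨k, not_le.1 (Nat.find_min hex (by omega)), ?_⟩
  rw [← Nat.succ_eq_add_one, ← hk]
  exact Nat.find_spec hex

theorem lowerSum_crossing_unique {δ : ℝ≥0} {t : ℝ≥0∞} {k l : ℕ}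
    (hk : lowerSum x δ k < t ∧ t ≤ lowerSum x δ (k + 1))
    (hl : lowerSum x δ l < t ∧ t ≤ lowerSum x δ (l + 1)) : k = l := by
  by_contra hne
  rcases Nat.lt_or_gt_of_ne hne with h | h
  · exact absurd (hk.2.trans (lowerSum_mono x δ h)) hl.1.not_ge
  · exact absurd (hl.2.trans (lowerSum_mono x δ h)) hk.1.not_ge

/-- The first crossing time of the lower sums converges from the right to the first crossing time
of the integral. -/
theorem tendsto_crossing (hx : Monotone x) (hc : ∀ t, ContinuousWithinAt x (Set.Ici t) t)
    {t : ℝ≥0} (ht : 0 < t) {R : ℝ≥0} (hR : ∀ s, (t : ℝ≥0∞) ≤ pathIntegral x s → R ≤ s)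
    (hR' : ∀ s, R < s → (t : ℝ≥0∞) ≤ pathIntegral x s) {δ : ℕ → ℝ≥0} (hδ0 : ∀ n, 0 < δ n)
    (hδ : Filter.Tendsto δ Filter.atTop (nhds 0)) {k : ℕ → ℕ}
    (hk : ∀ n, lowerSum x (δ n) (k n) < t ∧ (t : ℝ≥0∞) ≤ lowerSum x (δ n) (k n + 1)) (q : ℝ) :
    Filter.Tendsto (fun n => expNeg q (x (((k n + 1 : ℕ) : ℝ≥0) * δ n))) Filter.atTop
      (nhds (expNeg q (x R))) := by
  set s : ℕ → ℝ≥0 := fun n => ((k n + 1 : ℕ) : ℝ≥0) * δ n with hs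
  have hRs : ∀ n, R ≤ s n := fun n =>
    hR _ ((hk n).2.trans (lowerSum_le_pathIntegral hx _ _))
  rcases eq_or_ne (x R) ∞ with htop | hfin
  · have : ∀ n, x (s n) = ∞ := fun n => top_le_iff.1 (htop ▸ hx (hRs n))
    change Filter.Tendsto (fun n => expNeg q (x (s n))) _ _
    simp only [this, htop]
    exact tendsto_const_nhds
  suffices hlim : Filter.Tendsto s Filter.atTop (nhds R) from
    (continuousAt_expNeg q hfin).tendsto.comp ((hc R).tendsto.comp
      (tendsto_nhdsWithin_iff.2 ⟨hlim, Filter.Eventually.of_forall hRs⟩))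
  obtain ⟨ε₀, hε₀, hfin₀⟩ : ∃ ε : ℝ≥0, 0 < ε ∧ x (R + ε) < ∞ := by
    have h1 : ∀ᶠ u in nhdsWithin R (Set.Ici R), x u < ∞ :=
      (hc R).tendsto.eventually (gt_mem_nhds hfin.lt_top)
    have h2 : Filter.Tendsto (fun n => R + δ n) Filter.atTop (nhdsWithin R (Set.Ici R)) := by
      refine tendsto_nhdsWithin_iff.2 ⟨by simpa using hδ.const_add R, ?_⟩
      exact Filter.Eventually.of_forall fun n => Set.mem_Ici.2 le_self_add
    obtain ⟨n, hn⟩ := (h2.eventually h1).exists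
    exact ⟨δ n, hδ0 n, hn⟩
  refine tendsto_order.2 ⟨fun a ha => Filter.Eventually.of_forall fun n => ha.trans_le (hRs n),
    fun b hb => ?_⟩
  -- Four steps of size `ε` fit below `b` and inside the region where the path is finite: the
  -- contradiction below spends two on gaining area and at most one on rounding to the grid.
  obtain ⟨ε, hε, hεb, hεε⟩ : ∃ ε : ℝ≥0, 0 < ε ∧ R + 4 * ε < b ∧ 4 * ε ≤ ε₀ := by
    refine ⟨min ((b - R) / 8) (ε₀ / 4), lt_min (by have := tsub_pos_of_lt hb; positivity)
      (by positivity), ?_, ?_⟩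
    · have h1 : min ((b - R) / 8) (ε₀ / 4) ≤ (b - R) / 8 := min_le_left _ _
      have h2 : ((b - R : ℝ≥0) : ℝ) = b - R := NNReal.coe_sub hb.le
      rw [← NNReal.coe_le_coe] at h1
      have hb' : (R : ℝ) < b := NNReal.coe_lt_coe.2 hb
      rw [← NNReal.coe_lt_coe]
      push_cast at h1 ⊢
      rw [h2] at h1 ⊢
      linarith
    · have h1 : min ((b - R) / 8) (ε₀ / 4) ≤ ε₀ / 4 := min_le_right _ _
      rw [← NNReal.coe_le_coe] at h1 ⊢
      push_cast at h1 ⊢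
      linarith
  set y := x (R + 4 * ε) with hy
  have hyfin : y ≠ ∞ := ((hx (by gcongr)).trans_lt hfin₀).ne
  have hpos : 0 < x (R + ε) := by
    have h1 := (hR' (R + ε) (lt_add_of_pos_right _ hε)).trans (pathIntegral_le_mul hx _)
    refine pos_iff_ne_zero.2 fun h => ?_
    rw [h, mul_zero] at h1
    simp at h1
    exact ht.ne' h1
  have hsmall : ∀ᶠ n in Filter.atTop, (δ n : ℝ≥0∞) * y < ε * x (R + ε) := by
    have h1 : Filter.Tendsto (fun n => (δ n : ℝ≥0∞) * y) Filter.atTop (nhds (0 * y)) :=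
      ENNReal.Tendsto.mul_const (by simpa using ENNReal.tendsto_coe.2 hδ) (Or.inr hyfin)
    rw [zero_mul] at h1
    exact h1.eventually (gt_mem_nhds
      (pos_iff_ne_zero.2 (mul_ne_zero (by simpa using hε.ne') hpos.ne')))
  filter_upwards [hsmall, hδ.eventually (gt_mem_nhds hε)] with n hn hnε
  refine lt_of_le_of_lt ?_ hεb
  by_contra! hlt
  -- Last grid index up to `R + 4 ε`. If crossing came later, the lower sum at `m` would still be
  -- below `t`, while the integral up to `m δ` is at least `t + ε x (R + ε)`; the Riemann error, at
  -- most `δ y`, is too small to explain the gap.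
  set m := ⌊(R + 4 * ε) / δ n⌋₊ with hm
  have hm1 : m * δ n ≤ R + 4 * ε :=
    (le_div_iff₀ (hδ0 n)).1 (Nat.floor_le zero_le)
  have hm2 : R + 4 * ε ≤ m * δ n + δ n := by
    have := (div_le_iff₀ (hδ0 n)).1 (Nat.lt_floor_add_one ((R + 4 * ε) / δ n)).le
    rwa [add_one_mul] at this
  have hmk : m ≤ k n := by
    have h1 : (m : ℝ≥0) * δ n < ((k n + 1 : ℕ) : ℝ≥0) * δ n := hm1.trans_lt hlt
    have h2 := lt_of_mul_lt_mul_right h1 zero_le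
    exact Nat.lt_succ_iff.1 (by exact_mod_cast h2)
  have hlow : R + ε + ε ≤ m * δ n := by
    rw [← NNReal.coe_le_coe] at hm2 ⊢
    rw [← NNReal.coe_lt_coe] at hnε
    push_cast at hm2 ⊢
    linarith [ε.2]
  have hfinal : (t : ℝ≥0∞) + ε * x (R + ε) < t + ε * x (R + ε) := by
    calc (t : ℝ≥0∞) + ε * x (R + ε) ≤ pathIntegral x (R + ε) + ε * x (R + ε) := by
          gcongr; exact hR' _ (lt_add_of_pos_right _ hε)
      _ ≤ pathIntegral x (R + ε + ε) := pathIntegral_add_ge hx _ _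
      _ ≤ pathIntegral x (m * δ n) := pathIntegral_mono x hlow
      _ ≤ lowerSum x (δ n) m + δ n * x (m * δ n) := pathIntegral_le_lowerSum_add hx _ _
      _ ≤ lowerSum x (δ n) (k n) + δ n * y := by
          gcongr
          · exact lowerSum_mono x _ hmk
          · exact hx hm1
      _ < t + ε * x (R + ε) := ENNReal.add_lt_add (hk n).1 hn
  exact lt_irrefl _ hfinal

end IsSubordinator

namespace IsSubordinator

/-! ### The stopped exponential martingale along a grid -/

variable {Ω : Type*} {ξ : ℝ≥0 → Ω → ℝ≥0∞}

/-- The event that the lower sums cross the level `t` at step `k + 1`. -/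
def crossing (ξ : ℝ≥0 → Ω → ℝ≥0∞) (δ : ℝ≥0) (t : ℝ≥0) (k : ℕ) : Set Ω :=
  {ω | lowerSum (fun s => ξ s ω) δ k < t ∧ (t : ℝ≥0∞) ≤ lowerSum (fun s => ξ s ω) δ (k + 1)}

/-- Left endpoints make the sum predictable: the one with `l + 1` terms is already known at time `l
δ`. So crossing at step `k + 1` is decided before the increment after `k δ` is seen. -/
theorem measurable_past_lowerSum (δ : ℝ≥0) {k l : ℕ} (hk : k ≤ l + 1) :
    Measurable[past ξ (l * δ)] fun ω => lowerSum (fun s => ξ s ω) δ k := by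
  refine Finset.measurable_fun_sum _ fun j hj => ?_
  have hjl : j ≤ l := by have := Finset.mem_range.1 hj; omega
  have h : Measurable[past ξ (l * δ)] (ξ (j * δ)) := measurable_past (by gcongr)
  exact h.const_mul _

theorem measurableSet_past_lt (δ t : ℝ≥0) {k l : ℕ} (hk : k ≤ l + 1) :
    MeasurableSet[past ξ (l * δ)] {ω | lowerSum (fun s => ξ s ω) δ k < t} :=
  measurable_past_lowerSum δ hk measurableSet_Iio

theorem measurableSet_past_crossing (δ t : ℝ≥0) (k : ℕ) :
    MeasurableSet[past ξ (k * δ)] (crossing ξ δ t k) :=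
  MeasurableSet.inter (measurableSet_past_lt δ t k.le_succ)
    (measurable_past_lowerSum δ le_rfl measurableSet_Ici)

variable [MeasurableSpace Ω] {P : Measure Ω}

/-- A discretization of `exp (c A_r - c r ξ_r + ∫_0^r φ (c s) ds)`, where `A` is the integral
of `ξ`, at the time `r = k δ`. -/
noncomputable def expMart (ξ : ℝ≥0 → Ω → ℝ≥0∞) (P : Measure Ω) (c : ℝ) (δ : ℝ≥0) (k : ℕ) (ω : Ω) :
    ℝ≥0∞ :=
  ∏ j ∈ Finset.range k, (ENNReal.ofReal (Real.exp (δ * phi ξ P (c * (j * δ)))) *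
    ENNReal.ofReal (expNeg (c * (j * δ)) (ξ ((j + 1 : ℕ) * δ) ω - ξ (j * δ) ω)))

theorem expMart_succ (c : ℝ) (δ : ℝ≥0) (k : ℕ) (ω : Ω) :
    expMart ξ P c δ (k + 1) ω = expMart ξ P c δ k ω *
      (ENNReal.ofReal (Real.exp (δ * phi ξ P (c * (k * δ)))) *
        ENNReal.ofReal (expNeg (c * (k * δ)) (ξ ((k + 1 : ℕ) * δ) ω - ξ (k * δ) ω))) :=
  Finset.prod_range_succ _ _

theorem measurable_past_expMart (c : ℝ) (δ : ℝ≥0) (k : ℕ) :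
    Measurable[past ξ (k * δ)] (expMart ξ P c δ k) := by
  refine Finset.measurable_fun_prod _ fun j hj => ?_
  have hjk : j + 1 ≤ k := Finset.mem_range.1 hj
  have h1 : Measurable[past ξ (k * δ)] (ξ ((j + 1 : ℕ) * δ)) := measurable_past (by gcongr)
  have h2 : Measurable[past ξ (k * δ)] (ξ (j * δ)) :=
    measurable_past (by gcongr; omega)
  exact (((measurable_expNeg _).ennreal_ofReal).comp (h1.sub h2)).const_mul _

/-- The step at which killing occurs contributes `e^{-∞} = 0`, even for the exponent `0` at `j = 0`.
Later differences `∞ - ∞ = 0` cannot revive the product. -/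
theorem expMart_eq_zero (hξ : IsSubordinator ξ P) (c : ℝ) (δ : ℝ≥0) :
    ∀ᵐ ω ∂P, ∀ k : ℕ, ξ (k * δ) ω = ∞ → expMart ξ P c δ k ω = 0 := by
  filter_upwards [hξ.zero] with ω h0 k
  induction k with
  | zero => simp [h0]
  | succ k ih =>
    intro h
    rw [expMart_succ]
    by_cases hk : ξ (k * δ) ω = ∞
    · rw [ih hk, zero_mul]
    · rw [h, ENNReal.top_sub hk, expNeg_top]
      simp

/-- The martingale property: the new factor has mean one and is independent of the past while the
process is alive. -/
theorem setLIntegral_expMart_succ [IsProbabilityMeasure P] (hξ : IsSubordinator ξ P) {c : ℝ}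
    (hc : 0 ≤ c) (n k : ℕ) {B : Set Ω} (hB : MeasurableSet[past ξ (k * mesh n)] B) :
    ∫⁻ ω in B, expMart ξ P c (mesh n) (k + 1) ω ∂P = ∫⁻ ω in B, expMart ξ P c (mesh n) k ω ∂P := by
  have hB' := past_le hξ.measurable _ _ hB
  set p : ℝ := c * (k * mesh n) with hp
  have hp0 : 0 ≤ p := by positivity
  have hm : Measurable fun x => ENNReal.ofReal (Real.exp (mesh n * phi ξ P p)) *
      ENNReal.ofReal (expNeg p x) := (measurable_expNeg p).ennreal_ofReal.const_mul _
  rw [← lintegral_indicator hB', ← lintegral_indicator hB']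
  have h1 := hξ.lintegral_mul_increment (k * mesh n) (mesh n)
    (f := B.indicator (expMart ξ P c (mesh n) k))
    ((measurable_past_expMart c (mesh n) k).indicator hB) (by
      filter_upwards [expMart_eq_zero hξ c (mesh n)] with ω hω h
      by_cases hωB : ω ∈ B
      · rw [Set.indicator_of_mem hωB, hω k h]
      · rw [Set.indicator_of_notMem hωB]) hm
  have h2 : ∫⁻ ω, ENNReal.ofReal (Real.exp (mesh n * phi ξ P p)) *
      ENNReal.ofReal (expNeg p (ξ (mesh n) ω)) ∂P = 1 := by
    rw [lintegral_const_mul' _ _ ENNReal.ofReal_ne_top]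
    change _ * laplace ξ P p (mesh n) = 1
    rw [laplace_mesh hξ hp0, ← ENNReal.ofReal_mul (Real.exp_nonneg _), ← Real.exp_add]
    simp
  rw [h2, mul_one] at h1
  rw [← h1]
  congr 1
  ext ω
  by_cases hωB : ω ∈ B
  · rw [Set.indicator_of_mem hωB, Set.indicator_of_mem hωB, expMart_succ, Nat.cast_succ,
      add_one_mul]
  · rw [Set.indicator_of_notMem hωB, Set.indicator_of_notMem hωB, zero_mul]

theorem measurableSet_crossing (hξ : ∀ t, Measurable (ξ t)) (δ t : ℝ≥0) (k : ℕ) :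
    MeasurableSet (crossing ξ δ t k) :=
  past_le hξ _ _ (measurableSet_past_crossing δ t k)

/-- Optional stopping by induction: the uncrossed event splits into crossing now and not yet, both
decided at time `N δ`, so each piece keeps its integral over one more step. -/
theorem sum_setLIntegral_expMart_add_le [IsProbabilityMeasure P] (hξ : IsSubordinator ξ P) {c : ℝ}
    (hc : 0 ≤ c) (n : ℕ) (t : ℝ≥0) (N : ℕ) :
    (∑ k ∈ Finset.range N, ∫⁻ ω in crossing ξ (mesh n) t k, expMart ξ P c (mesh n) (k + 1) ω ∂P) +
      ∫⁻ ω in {ω | lowerSum (fun s => ξ s ω) (mesh n) N < t}, expMart ξ P c (mesh n) N ω ∂P ≤ 1 := by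
  induction N with
  | zero =>
    rw [Finset.sum_range_zero, zero_add]
    refine (setLIntegral_le_lintegral _ _).trans ?_
    simp [expMart]
  | succ N ih =>
    refine le_trans (le_of_eq ?_) ih
    have hlt := measurableSet_past_lt (ξ := ξ) (mesh n) t (le_refl (N + 1))
    have hsplit : {ω | lowerSum (fun s => ξ s ω) (mesh n) N < t} =
        crossing ξ (mesh n) t N ∪ {ω | lowerSum (fun s => ξ s ω) (mesh n) (N + 1) < t} := by
      ext ω
      constructor
      · intro h
        rcases lt_or_ge (lowerSum (fun s => ξ s ω) (mesh n) (N + 1)) (t : ℝ≥0∞) with h' | h'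
        · exact Or.inr h'
        · exact Or.inl ⟨h, h'⟩
      · rintro (h | h)
        · exact h.1
        · exact (lowerSum_mono _ _ N.le_succ).trans_lt h
    have hdisj : Disjoint (crossing ξ (mesh n) t N)
        {ω | lowerSum (fun s => ξ s ω) (mesh n) (N + 1) < t} :=
      Set.disjoint_left.2 fun ω h h' => h.2.not_gt h'
    rw [Finset.sum_range_succ, hsplit, lintegral_union (past_le hξ.measurable _ _ hlt) hdisj,
      setLIntegral_expMart_succ hξ hc n N hlt,
      setLIntegral_expMart_succ hξ hc n N (measurableSet_past_crossing _ t N), add_assoc]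

theorem tsum_setLIntegral_expMart_le [IsProbabilityMeasure P] (hξ : IsSubordinator ξ P) {c : ℝ}
    (hc : 0 ≤ c) (n : ℕ) (t : ℝ≥0) :
    ∑' k, ∫⁻ ω in crossing ξ (mesh n) t k, expMart ξ P c (mesh n) (k + 1) ω ∂P ≤ 1 := by
  rw [ENNReal.tsum_eq_iSup_nat]
  exact iSup_le fun N => le_self_add.trans (sum_setLIntegral_expMart_add_le hξ hc n t N)

/-! ### Pointwise lower bounds for the martingale -/

/-- Summation by parts, the discrete form of `∫ s dξ_s = r ξ_r - A_r`. -/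
theorem sum_range_mul_sub (y : ℕ → ℝ) (k : ℕ) :
    ∑ j ∈ Finset.range k, (j : ℝ) * (y (j + 1) - y j) =
      (k - 1) * y k + y 0 - ∑ j ∈ Finset.range k, y j := by
  induction k with
  | zero => simp
  | succ k ih => rw [Finset.sum_range_succ, ih, Finset.sum_range_succ]; push_cast; ring

theorem sum_range_mul_sub_le {y : ℕ → ℝ} (h0 : y 0 = 0) {k : ℕ} (hk : 0 ≤ y k) :
    ∑ j ∈ Finset.range k, (j : ℝ) * (y (j + 1) - y j) ≤ k * y k - ∑ j ∈ Finset.range k, y j := by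
  rw [sum_range_mul_sub, h0]
  linarith

theorem exp_le_expMart {ω : Ω} (h0 : ξ 0 ω = 0) (hmono : Monotone fun s => ξ s ω) {c : ℝ}
    (hc : 0 ≤ c) {δ t : ℝ≥0} {k : ℕ} (ht : (t : ℝ≥0∞) ≤ lowerSum (fun s => ξ s ω) δ k)
    (hfin : ξ (k * δ) ω ≠ ∞) :
    ENNReal.ofReal (Real.exp (c * t - c * (k * δ) * (ξ (k * δ) ω).toReal +
      ∑ j ∈ Finset.range k, δ * phi ξ P (c * (j * δ)))) ≤ expMart ξ P c δ k ω := by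
  set y : ℕ → ℝ := fun j => (ξ (j * δ) ω).toReal with hy
  have hfin' : ∀ j ≤ k, ξ (j * δ) ω ≠ ∞ := fun j hj => by
    have : ξ (j * δ) ω ≤ ξ (k * δ) ω := hmono (by gcongr)
    exact (this.trans_lt hfin.lt_top).ne
  have hM : expMart ξ P c δ k ω = ENNReal.ofReal (Real.exp (∑ j ∈ Finset.range k,
      (δ * phi ξ P (c * (j * δ)) - c * δ * (j * (y (j + 1) - y j))))) := by
    rw [Real.exp_sum, ENNReal.ofReal_prod_of_nonneg fun _ _ => Real.exp_nonneg _]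
    refine Finset.prod_congr rfl fun j hj => ?_
    have hjk : j + 1 ≤ k := Finset.mem_range.1 hj
    have h1 := hfin' (j + 1) hjk
    have h2 : ξ (j * δ) ω ≤ ξ ((j + 1 : ℕ) * δ) ω := hmono (by gcongr; simp)
    rw [← ENNReal.ofReal_mul (Real.exp_nonneg _), expNeg_of_ne_top _ (ENNReal.sub_ne_top h1),
      ENNReal.toReal_sub_of_le h2 h1, ← Real.exp_add]
    congr 2
    simp only [hy]
    ring
  rw [hM]
  refine ENNReal.ofReal_le_ofReal (Real.exp_le_exp.2 ?_)
  rw [Finset.sum_sub_distrib,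
    ← Finset.mul_sum (Finset.range k) (fun j => (j : ℝ) * (y (j + 1) - y j))]
  have h1 := sum_range_mul_sub_le (y := y) (by simp [hy, h0]) (k := k) ENNReal.toReal_nonneg
  have h2 : (t : ℝ) ≤ δ * ∑ j ∈ Finset.range k, y j := by
    have hne : lowerSum (fun s => ξ s ω) δ k ≠ ∞ :=
      ENNReal.sum_ne_top.2 fun j hj =>
        ENNReal.mul_ne_top ENNReal.coe_ne_top (hfin' j (Finset.mem_range.1 hj).le)
    have h3 := ENNReal.toReal_mono hne ht
    rw [lowerSum, ENNReal.toReal_sum fun j hj =>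
        ENNReal.mul_ne_top ENNReal.coe_ne_top (hfin' j (Finset.mem_range.1 hj).le)] at h3
    simpa [ENNReal.toReal_mul, Finset.mul_sum] using h3
  have h4 := mul_le_mul_of_nonneg_left h1 (show 0 ≤ c * δ by positivity)
  have h5 := mul_le_mul_of_nonneg_left h2 hc
  change _ - _ * y k + _ ≤ _
  linarith

theorem Phi_zero : Phi ξ P 0 = 0 := by simp [Phi]

/-- The terms `j ≥ 1` form a right-endpoint sum of a nondecreasing function, hence dominate the
integral; the term `j = 0` is nonnegative. -/
theorem Phi_div_le_sum [IsProbabilityMeasure P] (hξ : IsSubordinator ξ P) {c : ℝ} (hc : 0 < c)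
    (δ : ℝ≥0) (k : ℕ) :
    Phi ξ P (c * (k * δ)) / c ≤ ∑ j ∈ Finset.range (k + 1), δ * phi ξ P (c * (j * δ)) := by
  induction k with
  | zero => simpa [Phi_zero] using mul_nonneg δ.2 (phi_nonneg hξ le_rfl)
  | succ k ih =>
    rw [Finset.sum_range_succ]
    have h := phi_mul_sub_le hξ (x := c * ((k + 1 : ℕ) * δ)) (y := c * (k * δ)) (by positivity)
      (by positivity)
    rw [div_le_iff₀ hc] at ih ⊢
    push_cast at h ⊢
    linarith

/-! ### Choice of the slope -/

/-- A point `(s, y)` in the quadrant is never far on one and the same side of a square. -/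
theorem exists_sq_sub_mul_sub_le {s y : ℝ} (hs : 0 ≤ s) (hy : 0 ≤ y) :
    ∃ i : ℕ, (((i : ℝ) + 1) ^ 2 - s) * (((i : ℝ) + 1) ^ 2 - y) ≤ 9 * ((i : ℝ) + 1) ^ 2 := by
  wlog h : s ≤ y generalizing s y
  · obtain ⟨i, hi⟩ := this hy hs (le_of_not_ge h)
    exact ⟨i, by rwa [mul_comm]⟩
  have hsq : Real.sqrt y ^ 2 = y := Real.sq_sqrt hy
  have hlt := Nat.lt_floor_add_one (Real.sqrt y)
  have hle := Nat.floor_le (Real.sqrt_nonneg y)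
  rcases Nat.eq_zero_or_pos ⌊Real.sqrt y⌋₊ with h0 | h0
  · rw [h0] at hlt
    refine ⟨0, ?_⟩
    have : y ≤ 1 := by
      rw [← hsq]
      exact pow_le_one₀ (Real.sqrt_nonneg y) (by simpa using hlt.le)
    norm_num
    nlinarith
  · obtain ⟨i, hi⟩ := Nat.exists_eq_succ_of_ne_zero h0.ne'
    rw [hi] at hlt hle
    push_cast at hlt hle
    refine ⟨i, ?_⟩
    have h1 : ((i : ℝ) + 1) ^ 2 ≤ y := by
      rw [← hsq]; exact pow_le_pow_left₀ (by positivity) hle 2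
    have h2 : y ≤ ((i : ℝ) + 1 + 1) ^ 2 := by
      rw [← hsq]; exact pow_le_pow_left₀ (Real.sqrt_nonneg y) hlt.le 2
    -- Either the square separates `s` and `y`, so the product is nonpositive, or both lie between
    -- consecutive squares, whose gap `2 i + 3` is at most `3 (i + 1)`.
    rcases le_total s (((i : ℝ) + 1) ^ 2) with h3 | h3
    · nlinarith [mul_nonneg (sub_nonneg.2 h3) (sub_nonneg.2 h1)]
    · have hi0 : (0 : ℝ) ≤ i := Nat.cast_nonneg i
      have h4 : s - ((i : ℝ) + 1) ^ 2 ≤ 3 * (i + 1) := by nlinarith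
      have h5 : y - ((i : ℝ) + 1) ^ 2 ≤ 3 * (i + 1) := by nlinarith
      nlinarith [mul_le_mul h4 h5 (sub_nonneg.2 h1) (by positivity)]

/-- The slopes of the exponential martingales. -/
noncomputable def slope (q : ℝ) (i : ℕ) : ℝ := q / ((i : ℝ) + 1) ^ 2

theorem slope_pos {q : ℝ} (hq : 0 < q) (i : ℕ) : 0 < slope q i := by unfold slope; positivity

/-- The weights of the exponential martingales. -/
noncomputable def weight (ξ : ℝ≥0 → Ω → ℝ≥0∞) (P : Measure Ω) (q : ℝ) (t : ℝ≥0) (i : ℕ) : ℝ :=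
  Real.exp (10 * phi ξ P q - (slope q i * t + Phi ξ P q / slope q i))

theorem expNeg_le_tsum [IsProbabilityMeasure P] (hξ : IsSubordinator ξ P) {q : ℝ} (hq : 0 < q)
    (hφ : 0 < phi ξ P q) {ω : Ω} (h0 : ξ 0 ω = 0) (hmono : Monotone fun s => ξ s ω) {δ t : ℝ≥0}
    (hδ : δ ≤ 1) {k : ℕ} (ht : (t : ℝ≥0∞) ≤ lowerSum (fun s => ξ s ω) δ (k + 1)) :
    ENNReal.ofReal (expNeg q (ξ ((k + 1 : ℕ) * δ) ω)) ≤
      ∑' i, ENNReal.ofReal (weight ξ P q t i) * expMart ξ P (slope q i) δ (k + 1) ω := by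
  by_cases hfin : ξ ((k + 1 : ℕ) * δ) ω = ∞
  · rw [hfin, expNeg_top, ENNReal.ofReal_zero]
    exact zero_le
  set x := (ξ ((k + 1 : ℕ) * δ) ω).toReal with hx
  set s : ℝ := (k + 1 : ℕ) * δ with hs
  -- The scaling of `x` makes `φ q - c x` proportional to `r - y`, so the error term is a multiple
  -- of `(r - s) (r - y)`.
  obtain ⟨i, hi⟩ := exists_sq_sub_mul_sub_le (s := s) (y := q * x / phi ξ P q) (by positivity)
    (by positivity)
  refine le_trans ?_ (ENNReal.le_tsum i)
  set r : ℝ := ((i : ℝ) + 1) ^ 2 with hr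
  have hr0 : 0 < r := by positivity
  set c := slope q i with hc
  have hc0 : 0 < c := slope_pos hq i
  have hcr : c * r = q := div_mul_cancel₀ q hr0.ne'
  refine le_trans ?_ (mul_le_mul_right (exp_le_expMart h0 hmono hc0.le ht hfin) _)
  rw [weight, ← ENNReal.ofReal_mul (Real.exp_nonneg _), expNeg_of_ne_top _ hfin, ← Real.exp_add]
  refine ENNReal.ofReal_le_ofReal (Real.exp_le_exp.2 ?_)
  have h1 := Phi_div_le_sum hξ hc0 δ k
  -- The tangent is evaluated one mesh before `s`. This costs at most `φ q`, which with the `9 φ q`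
  -- from the squares gives the `10 φ q` in `weight`.
  have h2 := phi_mul_sub_le hξ (x := q) (y := c * (k * δ)) hq.le (by positivity)
  have h3 : -(9 * phi ξ P q) ≤ (phi ξ P q - c * x) * (s - r) := by
    have h4 : (phi ξ P q - c * x) * (s - r) =
        -(phi ξ P q / r * ((r - s) * (r - q * x / phi ξ P q))) := by
      rw [eq_div_of_mul_eq hr0.ne' hcr]; field_simp; ring
    rw [h4, neg_le_neg_iff]
    calc phi ξ P q / r * ((r - s) * (r - q * x / phi ξ P q)) ≤ phi ξ P q / r * (9 * r) := by gcongr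
      _ = 9 * phi ξ P q := by field_simp
  have h5 : phi ξ P q * (s - r) - phi ξ P q * δ + Phi ξ P q / c ≤ Phi ξ P (c * (k * δ)) / c := by
    rw [le_div_iff₀ hc0, add_mul, div_mul_cancel₀ _ hc0.ne']
    rw [← hcr] at h2 ⊢
    have : s = k * δ + δ := by rw [hs]; push_cast; ring
    rw [this]
    linarith
  have h6 : phi ξ P q * δ ≤ phi ξ P q := mul_le_of_le_one_right hφ.le (by exact_mod_cast hδ)
  have h7 : q * x = c * r * x := by rw [hcr]
  change _ ≤ _ + (_ - c * s * x + _)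
  linarith

/-- The good slope depends on the path; summing over all slopes removes this dependence, and each
stopped martingale has total mass at most one. -/
theorem tsum_setLIntegral_expNeg_le [IsProbabilityMeasure P] (hξ : IsSubordinator ξ P) {q : ℝ}
    (hq : 0 < q) (hφ : 0 < phi ξ P q) (n : ℕ) (t : ℝ≥0) :
    ∑' k, ∫⁻ ω in crossing ξ (mesh n) t k, ENNReal.ofReal (expNeg q (ξ ((k + 1 : ℕ) * mesh n) ω)) ∂P
      ≤ ∑' i, ENNReal.ofReal (weight ξ P q t i) := by
  have hm : ∀ c k, Measurable (expMart ξ P c (mesh n) k) := fun c k =>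
    (measurable_past_expMart c (mesh n) k).mono (past_le hξ.measurable _) le_rfl
  calc _ ≤ ∑' k, ∑' i, ENNReal.ofReal (weight ξ P q t i) *
        ∫⁻ ω in crossing ξ (mesh n) t k, expMart ξ P (slope q i) (mesh n) (k + 1) ω ∂P := by
        refine ENNReal.tsum_le_tsum fun k => ?_
        simp only [← lintegral_const_mul _ (hm _ _)]
        rw [← lintegral_tsum fun i => ((hm _ _).const_mul _).aemeasurable]
        refine setLIntegral_mono_ae' (measurableSet_crossing hξ.measurable _ _ _) ?_
        filter_upwards [hξ.zero, hξ.mono] with ω h0 hmono hω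
        exact expNeg_le_tsum hξ hq hφ h0 hmono (mesh_le_one n) hω.2
    _ = ∑' i, ENNReal.ofReal (weight ξ P q t i) *
        ∑' k, ∫⁻ ω in crossing ξ (mesh n) t k, expMart ξ P (slope q i) (mesh n) (k + 1) ω ∂P := by
        rw [ENNReal.tsum_comm]
        simp only [ENNReal.tsum_mul_left]
    _ ≤ ∑' i, ENNReal.ofReal (weight ξ P q t i) * 1 := by
        gcongr with i
        exact tsum_setLIntegral_expMart_le hξ (slope_pos hq i).le n t
    _ = _ := by simp

end IsSubordinator

namespace IsSubordinator

/-! ### Summation of the weights -/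

theorem summable_exp_neg_mul_abs {b : ℝ} (hb : 0 < b) :
    Summable fun j : ℤ => Real.exp (-(b * |(j : ℝ)|)) := by
  have h : Summable fun n : ℕ => Real.exp (-(b * n)) := by
    have := Real.summable_exp_nat_mul_iff.2 (neg_lt_zero.2 hb)
    exact this.congr fun n => by ring_nf
  refine Summable.of_nat_of_neg ?_ ?_ <;> simpa using h

/-- Gaussian sums over a shifted lattice are bounded uniformly in the shift. -/
theorem exists_tsum_gaussian_le {b : ℝ} (hb : 0 < b) : ∃ C : ℝ, 0 ≤ C ∧ ∀ x : ℝ,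
    ∑' i : ℕ, ENNReal.ofReal (Real.exp (-(b * ((i : ℝ) + 1 - x) ^ 2))) ≤ ENNReal.ofReal C := by
  refine ⟨∑' j : ℤ, Real.exp (3 * b) * Real.exp (-(2 * b * |(j : ℝ)|)),
    tsum_nonneg fun _ => by positivity, fun x => ?_⟩
  set f : ℤ → ℝ≥0∞ := fun j =>
    ENNReal.ofReal (Real.exp (3 * b) * Real.exp (-(2 * b * |(j : ℝ)|))) with hf
  rw [ENNReal.ofReal_tsum_of_nonneg (fun _ => by positivity)
    ((summable_exp_neg_mul_abs (b := 2 * b) (by positivity)).mul_left _)]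
  have hinj : Function.Injective fun i : ℕ => (i : ℤ) + 1 - ⌊x⌋ := fun i j h => by
    have : (i : ℤ) + 1 - ⌊x⌋ = j + 1 - ⌊x⌋ := h
    omega
  refine le_trans (ENNReal.tsum_le_tsum fun i => ?_) (ENNReal.tsum_comp_le_tsum_of_injective hinj f)
  simp only [hf]
  rw [← Real.exp_add]
  refine ENNReal.ofReal_le_ofReal (Real.exp_le_exp.2 ?_)
  push_cast
  have h1 := Int.floor_le x
  have h2 := Int.lt_floor_add_one x
  have h3 : |(i : ℝ) + 1 - ⌊x⌋| ≤ |(i : ℝ) + 1 - x| + 1 := by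
    have : |x - ⌊x⌋| ≤ 1 := abs_le.2 ⟨by linarith, by linarith⟩
    calc |(i : ℝ) + 1 - ⌊x⌋| = |((i : ℝ) + 1 - x) + (x - ⌊x⌋)| := by ring_nf
      _ ≤ _ := (abs_add_le _ _).trans (by gcongr)
  -- Together with `h3`, the square is at least `2 |j| - 3` for `j = i + 1 - ⌊x⌋`, which explains
  -- the factor `exp (3 b)`.
  have h4 : 2 * |(i : ℝ) + 1 - x| - 1 ≤ ((i : ℝ) + 1 - x) ^ 2 := by
    rw [← sq_abs]; nlinarith [sq_nonneg (|(i : ℝ) + 1 - x| - 1)]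
  nlinarith

/-- The elementary inequality behind the saddle point at `m = x`, where `x ^ 4 = q ^ 2 t / Φ`. -/
theorem saddle_le {q Φ t m : ℝ} (hq : 0 < q) (hΦ : 0 < Φ) (ht : 0 ≤ t) (hm : 0 < m) :
    2 * Real.sqrt (Φ * t) + Φ / q * (m - Real.sqrt (Real.sqrt (q ^ 2 * t / Φ))) ^ 2 ≤
      q / m ^ 2 * t + Φ / (q / m ^ 2) := by
  set x := Real.sqrt (Real.sqrt (q ^ 2 * t / Φ)) with hx
  have hx0 : 0 ≤ x := Real.sqrt_nonneg _
  have hx4 : x ^ 4 = q ^ 2 * t / Φ := by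
    rw [show x ^ 4 = (x ^ 2) ^ 2 by ring, hx, Real.sq_sqrt (Real.sqrt_nonneg _),
      Real.sq_sqrt (by positivity)]
  have ht' : t = Φ * x ^ 4 / q ^ 2 := by rw [hx4]; field_simp
  have hsqrt : Real.sqrt (Φ * t) = Φ / q * x ^ 2 := by
    rw [Real.sqrt_eq_iff_mul_self_eq (by positivity) (by positivity), ht']
    field_simp
  have hrhs : q / m ^ 2 * t + Φ / (q / m ^ 2) = Φ / q * (x ^ 4 / m ^ 2 + m ^ 2) := by
    rw [ht']; field_simp
  have hkey : 2 * x ^ 2 + (m - x) ^ 2 ≤ x ^ 4 / m ^ 2 + m ^ 2 := by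
    have h1 : x ^ 4 / m ^ 2 + m ^ 2 - 2 * x ^ 2 - (m - x) ^ 2 =
        (m - x) ^ 2 * (x ^ 2 + 2 * x * m) / m ^ 2 := by field_simp; ring
    have h2 : 0 ≤ (m - x) ^ 2 * (x ^ 2 + 2 * x * m) / m ^ 2 := by positivity
    linarith
  rw [hsqrt, hrhs]
  calc 2 * (Φ / q * x ^ 2) + Φ / q * (m - x) ^ 2 = Φ / q * (2 * x ^ 2 + (m - x) ^ 2) := by ring
    _ ≤ _ := by gcongr

variable {Ω : Type*} {ξ : ℝ≥0 → Ω → ℝ≥0∞}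

/-! ### Approximation of the time-changed process -/

theorem rho_eq (t : ℝ≥0) (ω : Ω) : rho ξ t ω =
    sInf ((fun r : ℝ≥0 => (r : ℝ≥0∞)) '' {r | (t : ℝ≥0∞) ≤ pathIntegral (fun s => ξ s ω) r}) := rfl

/-- The event that the whole path vanishes. -/
def zeroPath (ξ : ℝ≥0 → Ω → ℝ≥0∞) : Set Ω := ⋂ k : ℕ, {ω | ξ k ω = 0}

/-- The approximation of `exp (-q ξ_{ρ(t)})` obtained by stopping along the grid of mesh
`1 / (n + 1)`. -/
noncomputable def approx (ξ : ℝ≥0 → Ω → ℝ≥0∞) (q : ℝ) (t : ℝ≥0) (n : ℕ) (ω : Ω) : ℝ≥0∞ :=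
  (∑' k, (crossing ξ (mesh n) t k).indicator
    (fun ω => ENNReal.ofReal (expNeg q (ξ ((k + 1 : ℕ) * mesh n) ω))) ω) +
    (zeroPath ξ).indicator 1 ω

/-- On a nonzero path exactly one crossing index contributes. On the zero path there is no crossing
and `ρ(t) = ∞`, so the extra indicator supplies the value `1`. -/
theorem tendsto_approx {ω : Ω} (hmono : Monotone fun s => ξ s ω)
    (hc : ∀ t, ContinuousWithinAt (fun s => ξ s ω) (Set.Ici t) t) (q : ℝ) {t : ℝ≥0} (ht : 0 < t) :
    Filter.Tendsto (fun n => approx ξ q t n ω) Filter.atTop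
      (nhds (ENNReal.ofReal (expNeg q (timeChanged ξ t ω)))) := by
  by_cases hz : ω ∈ zeroPath ξ
  · have hzero : ∀ s, ξ s ω = 0 := fun s => by
      obtain ⟨k, hk⟩ := exists_nat_ge s
      have h1 : ξ k ω = 0 := Set.mem_iInter.1 hz k
      exact le_antisymm ((hmono hk).trans h1.le) zero_le
    have hrho : rho ξ t ω = ∞ := by
      rw [rho_eq]
      have : {r | (t : ℝ≥0∞) ≤ pathIntegral (fun s => ξ s ω) r} = ∅ := by
        ext r; simp [pathIntegral, hzero, ht.ne']
      rw [this, Set.image_empty, sInf_empty]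
    have h1 : ENNReal.ofReal (expNeg q (timeChanged ξ t ω)) = 1 := by
      simp [timeChanged, hrho, hzero, expNeg]
    have h2 : ∀ n, approx ξ q t n ω = 1 := fun n => by
      have : ∀ k, ω ∉ crossing ξ (mesh n) t k := fun k hk => by
        have := hk.2
        simp [lowerSum, hzero, ht.ne'] at this
      simp [approx, this, hz]
    simp only [h1, h2]
    exact tendsto_const_nhds
  · obtain ⟨u, hu⟩ : ∃ u : ℕ, ξ u ω ≠ 0 := by
      simpa [zeroPath] using hz
    have hcross := fun n => exists_lowerSum_crossing hmono hu (mesh_pos n) ht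
    choose k hk using hcross
    have hlt : rho ξ t ω < ∞ := by
      rw [rho_eq]
      refine (sInf_le (Set.mem_image_of_mem (fun r : ℝ≥0 => (r : ℝ≥0∞))
        (show ((k 0 + 1 : ℕ) : ℝ≥0) * mesh 0 ∈ _ from ?_))).trans_lt ENNReal.coe_lt_top
      exact (hk 0).2.trans (lowerSum_le_pathIntegral hmono _ _)
    have hR : ((rho ξ t ω).toNNReal : ℝ≥0∞) = rho ξ t ω := ENNReal.coe_toNNReal hlt.ne
    have h1 : ∀ n, approx ξ q t n ω =
        ENNReal.ofReal (expNeg q (ξ ((k n + 1 : ℕ) * mesh n) ω)) := fun n => by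
      rw [approx, Set.indicator_of_notMem hz, add_zero, tsum_eq_single (k n),
        Set.indicator_of_mem (show ω ∈ crossing ξ (mesh n) t (k n) from hk n)]
      intro l hl
      exact Set.indicator_of_notMem (fun h : ω ∈ crossing ξ (mesh n) t l =>
        hl (lowerSum_crossing_unique h (hk n))) _
    simp only [h1]
    rw [timeChanged, if_neg hlt.ne]
    refine (ENNReal.continuous_ofReal.tendsto _).comp
      (tendsto_crossing hmono hc ht (R := (rho ξ t ω).toNNReal) ?_ ?_ mesh_pos tendsto_mesh hk q)
    · intro s hs
      rw [← ENNReal.coe_le_coe, hR, rho_eq]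
      exact sInf_le ⟨s, hs, rfl⟩
    · intro s hs
      rw [← ENNReal.coe_lt_coe, hR, rho_eq, sInf_lt_iff] at hs
      obtain ⟨_, ⟨r, hr, rfl⟩, hrs⟩ := hs
      exact hr.trans (pathIntegral_mono _ (ENNReal.coe_le_coe.1 hrs.le))

theorem rho_zero (ω : Ω) : rho ξ 0 ω = 0 :=
  le_antisymm (sInf_le ⟨0, by simp, rfl⟩) zero_le

theorem timeChanged_zero (ω : Ω) : timeChanged ξ 0 ω = ξ 0 ω := by
  simp [timeChanged, rho_zero]

/-! ### Measurability and removal of the grid -/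

variable [MeasurableSpace Ω] {P : Measure Ω}

theorem measurableSet_zeroPath (hξ : ∀ t, Measurable (ξ t)) : MeasurableSet (zeroPath ξ) :=
  MeasurableSet.iInter fun k => hξ k (measurableSet_singleton 0)

theorem measurable_approx (hξ : ∀ t, Measurable (ξ t)) (q : ℝ) (t : ℝ≥0) (n : ℕ) :
    Measurable (approx ξ q t n) :=
  (Measurable.tsum fun _ => (((measurable_expNeg q).comp (hξ _)).ennreal_ofReal).indicator
    (measurableSet_crossing hξ _ _ _)).add
    (measurable_one.indicator (measurableSet_zeroPath hξ))

theorem exists_tsum_weight_le {q : ℝ} (hq : 0 < q) (hΦ : 0 < Phi ξ P q) :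
    ∃ C : ℝ, 0 ≤ C ∧ ∀ t : ℝ≥0, ∑' i, ENNReal.ofReal (weight ξ P q t i) ≤
      ENNReal.ofReal (C * Real.exp (-(2 * Real.sqrt (Phi ξ P q * t)))) := by
  obtain ⟨C, hC0, hC⟩ := exists_tsum_gaussian_le (div_pos hΦ hq)
  refine ⟨Real.exp (10 * phi ξ P q) * C, by positivity, fun t => ?_⟩
  set x := Real.sqrt (Real.sqrt (q ^ 2 * t / Phi ξ P q)) with hx
  set E := Real.exp (10 * phi ξ P q) * Real.exp (-(2 * Real.sqrt (Phi ξ P q * t))) with hE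
  calc _ ≤ ∑' i : ℕ, ENNReal.ofReal E *
        ENNReal.ofReal (Real.exp (-(Phi ξ P q / q * ((i : ℝ) + 1 - x) ^ 2))) := by
        refine ENNReal.tsum_le_tsum fun i => ?_
        rw [← ENNReal.ofReal_mul (by positivity), hE, weight, ← Real.exp_add, ← Real.exp_add]
        refine ENNReal.ofReal_le_ofReal (Real.exp_le_exp.2 ?_)
        have := saddle_le hq hΦ t.coe_nonneg (show (0 : ℝ) < (i : ℝ) + 1 by positivity)
        rw [slope]
        change _ + _ * (_ - x) ^ 2 ≤ _ * (t : ℝ) + _ at this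
        linarith
    _ ≤ ENNReal.ofReal E * ENNReal.ofReal C := by
        rw [ENNReal.tsum_mul_left]
        gcongr
        exact hC x
    _ = _ := by
        rw [← ENNReal.ofReal_mul (by positivity), hE]
        ring_nf

theorem ae_tendsto_approx (hξ : IsSubordinator ξ P) (q : ℝ) {t : ℝ≥0} (ht : 0 < t) :
    ∀ᵐ ω ∂P, Filter.Tendsto (fun n => approx ξ q t n ω) Filter.atTop
      (nhds (ENNReal.ofReal (expNeg q (timeChanged ξ t ω)))) := by
  filter_upwards [hξ.mono, hξ.rightCont] with ω hmono hc
  exact tendsto_approx hmono hc q ht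

/-- Measurability of the time-changed process is obtained only almost everywhere, as a limit of the
grid approximations; these need `t > 0`. -/
theorem integrable_expNeg_timeChanged [IsProbabilityMeasure P] (hξ : IsSubordinator ξ P) {q : ℝ}
    (hq : 0 ≤ q) (t : ℝ≥0) : Integrable (fun ω => expNeg q (timeChanged ξ t ω)) P := by
  rcases eq_or_ne t 0 with rfl | ht
  · simp only [timeChanged_zero]
    exact integrable_expNeg hq (hξ.measurable 0).aemeasurable
  have h1 : AEMeasurable (fun ω => ENNReal.ofReal (expNeg q (timeChanged ξ t ω))) P :=
    aemeasurable_of_tendsto_metrizable_ae Filter.atTop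
      (fun n => (measurable_approx hξ.measurable q t n).aemeasurable)
      (ae_tendsto_approx hξ q (pos_iff_ne_zero.2 ht))
  have h2 : AEMeasurable (fun ω => expNeg q (timeChanged ξ t ω)) P :=
    h1.ennreal_toReal.congr (Filter.Eventually.of_forall fun ω =>
      ENNReal.toReal_ofReal (expNeg_nonneg _ _))
  refine Integrable.of_bound h2.aestronglyMeasurable 1 (Filter.Eventually.of_forall fun ω => ?_)
  rw [Real.norm_of_nonneg (expNeg_nonneg _ _)]
  exact expNeg_le_one hq _

/-- The zero path forces `ξ n = 0`, an event of probability at most `E e^{-q ξ_n} = e^{-n φ(q)}`,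
which tends to zero. -/
theorem measure_zeroPath [IsProbabilityMeasure P] (hξ : IsSubordinator ξ P) {q : ℝ} (hq : 0 ≤ q)
    (hφ : 0 < phi ξ P q) : P (zeroPath ξ) = 0 := by
  have hle : ∀ n : ℕ, P (zeroPath ξ) ≤ laplace ξ P q 1 ^ n := fun n => by
    rw [← laplace_nat_mul hξ, mul_one, laplace, ← lintegral_indicator_one
      (measurableSet_zeroPath hξ.measurable)]
    refine lintegral_mono fun ω => ?_
    by_cases hω : ω ∉ zeroPath ξ
    · simp [hω]
    rw [not_not] at hω
    have : ξ n ω = 0 := Set.mem_iInter.1 hω n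
    simp [this, expNeg, hω]
  have hlt : laplace ξ P q 1 < 1 := by
    rw [laplace_one hξ hq, ENNReal.ofReal_lt_one, Real.exp_lt_one_iff]
    exact neg_lt_zero.2 hφ
  exact le_antisymm (ge_of_tendsto' (ENNReal.tendsto_pow_atTop_nhds_zero_of_lt_one hlt) hle)
    zero_le

theorem lintegral_expNeg_timeChanged_le [IsProbabilityMeasure P] (hξ : IsSubordinator ξ P) {q : ℝ}
    (hq : 0 < q) (hφ : 0 < phi ξ P q) {t : ℝ≥0} (ht : 0 < t) :
    ∫⁻ ω, ENNReal.ofReal (expNeg q (timeChanged ξ t ω)) ∂P ≤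
      ∑' i, ENNReal.ofReal (weight ξ P q t i) := by
  have hm := measurable_approx hξ.measurable q t
  have hle : ∀ n, ∫⁻ ω, approx ξ q t n ω ∂P ≤ ∑' i, ENNReal.ofReal (weight ξ P q t i) := fun n => by
    have hcm := measurableSet_crossing hξ.measurable (mesh n) t
    simp only [approx]
    rw [lintegral_add_right _ (measurable_one.indicator (measurableSet_zeroPath hξ.measurable)),
      lintegral_indicator_one (measurableSet_zeroPath hξ.measurable), measure_zeroPath hξ hq.le hφ,
      add_zero, lintegral_tsum fun k => (Measurable.indicator ?_ (hcm k)).aemeasurable]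
    · simp only [lintegral_indicator (hcm _)]
      exact tsum_setLIntegral_expNeg_le hξ hq hφ n t
    · exact ((measurable_expNeg q).comp (hξ.measurable _)).ennreal_ofReal
  calc _ = ∫⁻ ω, Filter.liminf (fun n => approx ξ q t n ω) Filter.atTop ∂P := by
        refine lintegral_congr_ae ?_
        filter_upwards [ae_tendsto_approx hξ q ht] with ω hω
        exact hω.liminf_eq.symm
    _ ≤ Filter.liminf (fun n => ∫⁻ ω, approx ξ q t n ω ∂P) Filter.atTop := lintegral_liminf_le hm
    _ ≤ _ := Filter.liminf_le_of_le (by isBoundedDefault) fun b hb => by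
        obtain ⟨n, hn⟩ := hb.exists
        exact hn.trans (hle n)

end IsSubordinator

theorem proposition2 {Ω : Type*} [MeasurableSpace Ω] (P : Measure Ω) [IsProbabilityMeasure P]
    (ξ : ℝ≥0 → Ω → ℝ≥0∞) (hξ : IsSubordinator ξ P) (q : ℝ) (hq : 0 < q) :
    ∃ a : ℝ, 0 < a ∧ ∀ t : ℝ≥0,
      Integrable (fun ω => IsSubordinator.expNeg q (IsSubordinator.timeChanged ξ t ω)) P ∧
      ∫ ω, IsSubordinator.expNeg q (IsSubordinator.timeChanged ξ t ω) ∂P ≤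
        a * (1 + (t : ℝ) ^ (1 / 8 : ℝ)) *
          Real.exp (-(2 * Real.sqrt (IsSubordinator.Phi ξ P q * t))) := by
  open IsSubordinator in
  have hint := fun t => integrable_expNeg_timeChanged hξ hq.le t
  have hone : ∀ t, ∫ ω, expNeg q (timeChanged ξ t ω) ∂P ≤ 1 := fun t =>
    (integral_mono (hint t) (integrable_const _) fun _ => expNeg_le_one hq.le _).trans (by simp)
  -- A bound with no power of `t`. The summand `1` keeps the constant positive and absorbs the cases
  -- `Φ(q) ≤ 0` and `t = 0`, where the exponential equals `1`.
  suffices h : ∃ C : ℝ, 0 ≤ C ∧ ∀ t : ℝ≥0, ∫ ω, expNeg q (timeChanged ξ t ω) ∂P ≤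
      (C + 1) * Real.exp (-(2 * Real.sqrt (Phi ξ P q * t))) by
    obtain ⟨C, hC0, hC⟩ := h
    refine ⟨C + 1, by positivity, fun t => ⟨hint t, (hC t).trans ?_⟩⟩
    gcongr
    exact le_mul_of_one_le_right (by positivity) (le_add_of_nonneg_right (by positivity))
  rcases le_or_gt (Phi ξ P q) 0 with hΦ | hΦ
  · refine ⟨0, le_rfl, fun t => (hone t).trans ?_⟩
    rw [Real.sqrt_eq_zero_of_nonpos (mul_nonpos_of_nonpos_of_nonneg hΦ t.coe_nonneg)]
    simp
  have hφ : 0 < phi ξ P q := by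
    -- The tangent at `q`, evaluated at `0`, gives `Φ(q) ≤ q φ(q)`.
    have h := phi_mul_sub_le hξ (x := q) (y := 0) hq.le le_rfl
    rw [Phi_zero] at h
    by_contra! hneg
    nlinarith
  obtain ⟨C, hC0, hC⟩ := exists_tsum_weight_le hq hΦ
  refine ⟨C, hC0, fun t => ?_⟩
  rcases eq_or_ne t 0 with rfl | ht
  · refine (hone 0).trans ?_
    simp [hC0]
  rw [integral_eq_lintegral_of_nonneg_ae (Filter.Eventually.of_forall fun _ => expNeg_nonneg _ _)
    (hint t).aestronglyMeasurable]
  refine ENNReal.toReal_le_of_le_ofReal (by positivity) ?_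
  refine ((lintegral_expNeg_timeChanged_le hξ hq hφ (pos_iff_ne_zero.2 ht)).trans (hC t)).trans ?_
  exact ENNReal.ofReal_le_ofReal (by gcongr; exact le_add_of_nonneg_right zero_le_one)
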